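/- **Setting.** There are $n\ge 3f+1$ nodes; a set $B$ of at most $f$ of them is corrupted before the execution starts, the others are honest. For each sender $P_i$ and each residue modulo $\varphi\ge 1$ a committee is drawn, uniformly among the sets of $n_c$ nodes; $N(i,r)$ denotes the committee of $P_i$ for $r \bmod \varphi$. Signatures, threshold signatures and hashes are ideal. A round-$r$ message $m$ of $P_i$ carries a content, $\mathrm{cert}(m_{r-1}^i)$ (its parent certificate), a set $\mathrm{prev}$ of certificates of round-$(r-1)$ messages, and an array $\mathrm{triggers}$ of certificates; $\mathrm{cert}(m)$ is valid once $\lfloor n_c/2\rfloor+1$ distinct members of $N(i,r)$ have signed $m$. The *causal chain* of $m$ consists of $m$ and the messages of $P_i$ reached from it by repeatedly following valid parent certificates. **Protocol (APM-BRB), as run by each honest node.** (a) It keeps write-once entries $\mathrm{promises}[i][r]$, filled in order of $r$: a round-1 message of $P_i$, or, for $r>1$, a message of $P_i$ whose parent certificate is a valid certificate of $\mathrm{promises}[i][r-1]$. (b) In each round $r$ it sends one message; for $r>1$ this contains a certificate of its own round-$(r-1)$ message and, in $\mathrm{prev}$, valid certificates of $\mathrm{promises}[j][r-1]$ for $2f+1$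 distinct $j$. (c) As a member of $N(i,r)$ it signs only the first round-$r$ message that it receives from $P_i$, and, if $r>1$, only if the parent certificate of this message is a valid certificate of $\mathrm{promises}[i][r-1]$. (d) *Deliver Condition 1*: on a valid $\mathrm{cert}(m_R^i)$ with $R\ge\varphi$ it delivers the messages of rounds $R-\varphi,\dots,1$ in the causal chain of $m_R^i$. (e) *Deliver Condition 2, optimistic rule*: if it obtains certified round-$r$ messages of all $n$ nodes and $\mathrm{cert}(m_{r-1}^i)$ is in the $\mathrm{prev}$ set of all of them, it delivers $m_{r-1}^i$ and its causal chain down to round 1. (f) *Deliver Condition 2, quorum rule*: if it has delivered round-$r$ messages of $2f+1$ distinct nodes and a valid $\mathrm{cert}(m_{r-1}^i)$ is in the $\mathrm{prev}$ set of all of them, it delivers $m_{r-1}^i$ and its causal chain down to round 1. Corrupted nodes are arbitrary except that they cannot forge; messages may be delayed and reordered arbitrarily (so a random schedule is included). **Lemma (Deliver Condition 2 of APM-BRB satisfies Agreement).** Let $\varepsilon>0$ and fix a sender $P_j$. 1. If $n_c\ge 18\ln(\varphi/\varepsilon)$, then with probability at least $1-\varepsilon$ the following holds for all rounds. If an honest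 node delivers $m$ for $(P_j,u)$ by the optimistic rule and an honest node delivers $m'$ for $(P_j,u)$ by any rule, at any time, then $m=m'$. Moreover, whenever $\mathrm{cert}(m^j_{r-1})$ is in the $\mathrm{prev}$ sets of certified round-$r$ messages of all $n$ nodes, the causal chain of $m^j_{r-1}$ contains a message of every round $u=r-1,\dots,1$, every honest node can deliver it by the optimistic rule once it has obtained these messages, and no honest node ever delivers, by any rule, a different message for $(P_j,u)$. 2. Let $n=3f+1$ and suppose that, with probability at least $1-\varepsilon$, the following two assumptions hold: every committee of $P_j$ has a majority of honest nodes; and, for each certified chain of messages of $P_j$ from a round $r$ to round $r+\varphi$, at least $f+1$ distinct honest nodes sign at least one of its messages of rounds $r+1,\dots,r+\varphi$. Then, with probability at least $1-\varepsilon$: if an honest node delivers $m$ for $(P_j,u)$ by either rule of Deliver Condition 2 and an honest node delivers $m'$ for $(P_j,u)$ by any rule, at any time, then $m=m'$. -/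

import Mathlib

open MeasureTheory

namespace APMBRB

universe u

/-- A protocol message of one of `n` nodes, with payload in `α`.  Certificates are symbolic
(ideal threshold signatures and hashes): a field that holds a certificate `cert(m)` stores the
message `m` that it certifies, and whether it is valid is decided by `Certified` below.
* `parent` is the certificate of the message of the same sender in the preceding round;
* `prev` is the collection of certificates of messages of the preceding round;
* `triggers` holds, for each node, at most one certificate (the round is that of its message). -/
structure Msg (n : ℕ) (α : Type u) where
  content : α
  sender : Fin n
  round : ℕ
  parent : Option (Msg n α)
  prev : List (Msg n α)
  triggers : Fin n → Option (Msg n α)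

/-- Parameters of one instance: fault bound `f`, chain length `φ`, committee size `nc`, the
statically corrupted nodes, and the sampled committees (`slot i s` is the committee of sender `i`
for all rounds congruent to `s` modulo `φ`). -/
structure Setup (n : ℕ) where
  f : ℕ
  φ : ℕ
  nc : ℕ
  byz : Finset (Fin n)
  slot : Fin n → ℕ → Finset (Fin n)

/-- `sampleCommittee(i, r)`; committees repeat every `φ` rounds. -/
def Setup.committee {n : ℕ} (S : Setup n) (i : Fin n) (r : ℕ) : Finset (Fin n) :=
  S.slot i (r % S.φ)

/-- The rule by which a message is delivered:
* `certChain`: Deliver Condition 1 (a chain of `φ` certificates on top of the message);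
* `optimistic`: Deliver Condition 2, first rule (a certificate occurs in `prev` of all `n`
  messages of a round);
* `quorum`: Deliver Condition 2, second rule (a certificate occurs in `prev` of `2f+1` delivered
  messages of a round). -/
inductive Rule where
  | certChain
  | optimistic
  | quorum

/-- A global state.  `msgs` and `shares` are all messages and all signature shares `⟨m⟩_k` (as
pairs `(k, m)`) that were ever put on the network; a node may receive any of them at any later
time, in any order, or never.  The other components are the local variables of the nodes (those
of corrupted nodes are not used). -/
structure State (n : ℕ) (α : Type u) where
  msgs : Set (Msg n α)
  shares : Set (Fin n × Msg n α)
  /-- `sent p r`: the message that `p` has sent as its round-`r` message. -/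
  sent : Fin n → ℕ → Option (Msg n α)
  /-- `seen p i r`: the first round-`r` message of `i` received by the committee member `p`. -/
  seen : Fin n → Fin n → ℕ → Option (Msg n α)
  /-- `promises p i r`: the entry `promises[i][r]` of `p`. -/
  promises : Fin n → Fin n → ℕ → Option (Msg n α)
  /-- `triggers p i`: the entry `triggers[i]` of `p`. -/
  triggers : Fin n → Fin n → Option (Msg n α)
  /-- `(p, m)`: node `p` has called `processCertificate` with a valid `cert(m)`. -/
  processed : Set (Fin n × Msg n α)
  /-- `(p, ρ, m)`: node `p` has called `Deliver_i(m, r)` by rule `ρ`, where `i` and `r` are the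
  sender and the round of `m`. -/
  delivered : Set (Fin n × Rule × Msg n α)

/-- The initial state: nothing has happened. -/
def State.init (n : ℕ) (α : Type u) : State n α where
  msgs := ∅
  shares := ∅
  sent := fun _ _ => none
  seen := fun _ _ _ => none
  promises := fun _ _ _ => none
  triggers := fun _ _ => none
  processed := ∅
  delivered := ∅

section Protocol

variable {n : ℕ} {α : Type u} (S : Setup n) (s : State n α)

/-- `cert(m)` exists: `⌊nc/2⌋+1` distinct members of the committee of `m` have signed `m`. -/
def Certified (m : Msg n α) : Prop :=
  ∃ K : Finset (Fin n), K ⊆ S.committee m.sender m.round ∧ S.nc / 2 + 1 ≤ K.card ∧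
    ∀ k ∈ K, (k, m) ∈ s.shares

/-- One step backwards in a causal chain: `x` contains a valid `cert(y)` for the message `y` of the
same sender in the preceding round, and `y` can be obtained. -/
def Extends (x y : Msg n α) : Prop :=
  x.parent = some y ∧ y.sender = x.sender ∧ y.round + 1 = x.round ∧ Certified S s y ∧ y ∈ s.msgs

/-- `y` belongs to the causal chain that ends in `x` (possibly `y = x`). -/
def Chain : Msg n α → Msg n α → Prop :=
  Relation.ReflTransGen (Extends S s)

/-- Node `p` accepts `m` as an extension of its promises: either `m` is a round-`1` message, or
`m` contains a valid certificate for the entry of `p`'s promises in the preceding round. -/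
def ExtendsPromise (p : Fin n) (m : Msg n α) : Prop :=
  m.round = 1 ∨ ∃ x, m.parent = some x ∧ x.round + 1 = m.round ∧
    s.promises p m.sender x.round = some x ∧ Certified S s x

/-- `m` is a message that the honest node `p` may send next: it carries the current triggers, and
either it is the round-`1` message, or its round is `r + 1` where `p` holds a certificate for its
own round-`r` message, which becomes `parent`, and `prev` consists of the certificates of `p`'s
promises in round `r` for `2f+1` distinct nodes. -/
def MaySend (p : Fin n) (m : Msg n α) : Prop :=
  m.sender = p ∧ s.sent p m.round = none ∧ m.triggers = s.triggers p ∧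
  ((m.round = 1 ∧ m.parent = none ∧ m.prev = []) ∨
    ∃ r x, m.round = r + 1 ∧ s.sent p r = some x ∧ Certified S s x ∧ m.parent = some x ∧
      ∃ J : Finset (Fin n), J.card = 2 * S.f + 1 ∧
        (∀ j ∈ J, ∃ y, s.promises p j r = some y ∧ Certified S s y) ∧
        ∀ y, y ∈ m.prev ↔ ∃ j ∈ J, s.promises p j r = some y)

/-- The condition of the optimistic rule in round `r`: a certified round-`r` message of each of the
`n` nodes is available, and `cert(x)`, where `x` has round `r - 1`, occurs in `prev` of all of
them. -/
def OptimisticCondition (r : ℕ) (x : Msg n α) : Prop :=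
  x.round + 1 = r ∧ ∃ M : Fin n → Msg n α, ∀ k, (M k).sender = k ∧ (M k).round = r ∧
    M k ∈ s.msgs ∧ Certified S s (M k) ∧ x ∈ (M k).prev

/-- The condition of the second rule in round `r`, at node `p`: it has delivered round-`r` messages
of `2f+1` distinct nodes, and `cert(x)`, where `x` has round `r - 1`, occurs in `prev` of all of
them. -/
def QuorumCondition (p : Fin n) (r : ℕ) (x : Msg n α) : Prop :=
  x.round + 1 = r ∧ ∃ (Q : Finset (Fin n)) (M : Fin n → Msg n α), Q.card = 2 * S.f + 1 ∧
    ∀ k ∈ Q, (M k).sender = k ∧ (M k).round = r ∧ (∃ ρ, (p, ρ, M k) ∈ s.delivered) ∧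
      x ∈ (M k).prev

/-- Node `p` may call `Deliver` on `y` by the given rule.  Condition 1 walks back from a processed
certificate and delivers everything at least `φ` rounds below it; both rules of Condition 2 deliver
the message `x` of the preceding round together with its causal chain down to round `1`. -/
def MayDeliver (p : Fin n) : Rule → Msg n α → Prop
  | .certChain, y => ∃ top, (p, top) ∈ s.processed ∧ top ∈ s.msgs ∧ Chain S s top y ∧
      1 ≤ y.round ∧ y.round + S.φ ≤ top.round
  | .optimistic, y => ∃ r x, OptimisticCondition S s r x ∧ Certified S s x ∧ x ∈ s.msgs ∧
      Chain S s x y ∧ 1 ≤ y.round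
  | .quorum, y => ∃ r x, QuorumCondition S s p r x ∧ Certified S s x ∧ x ∈ s.msgs ∧
      Chain S s x y ∧ 1 ≤ y.round

/-- One atomic step.  Corrupted nodes may do anything except forging: they can issue arbitrary
messages in the name of corrupted nodes and arbitrary signature shares of corrupted nodes.
Scheduling is unrestricted. -/
inductive Step : State n α → Prop
  | byzMsg (m : Msg n α) (h : m.sender ∈ S.byz) :
      Step { s with msgs := insert m s.msgs }
  | byzShare (k : Fin n) (m : Msg n α) (h : k ∈ S.byz) :
      Step { s with shares := insert (k, m) s.shares }
  /-- `p` sends its message of a new round. -/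
  | send (p : Fin n) (m : Msg n α) (hp : p ∉ S.byz) (h : MaySend S s p m) :
      Step { s with
        msgs := insert m s.msgs
        sent := fun q r => if q = p ∧ r = m.round then some m else s.sent q r }
  /-- `fetchMsg` (for `syncMsg` and `reqMsg`): `p` writes the next entry of `promises[i]`,
  `i` being the sender of `m`; entries are never overwritten. -/
  | promise (p : Fin n) (m : Msg n α) (hp : p ∉ S.byz) (hm : m ∈ s.msgs)
      (hnew : s.promises p m.sender m.round = none) (h : ExtendsPromise S s p m) :
      Step { s with
        promises := fun q i r =>
          if q = p ∧ i = m.sender ∧ r = m.round then some m else s.promises q i r }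
  /-- Committee member `p` receives a first message of the sender for the round. -/
  | receive (p : Fin n) (m : Msg n α) (hp : p ∉ S.byz) (hm : m ∈ s.msgs)
      (hc : p ∈ S.committee m.sender m.round) (hnew : s.seen p m.sender m.round = none) :
      Step { s with
        seen := fun q i r =>
          if q = p ∧ i = m.sender ∧ r = m.round then some m else s.seen q i r }
  /-- `p` signs the received message if it extends its promises (the message itself is already
  on the network, so that re-sending it does not change the state). -/
  | sign (p : Fin n) (m : Msg n α) (hp : p ∉ S.byz)
      (hseen : s.seen p m.sender m.round = some m) (h : ExtendsPromise S s p m) :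
      Step { s with shares := insert (p, m) s.shares }
  /-- `processCertificate`, called with a valid `cert(m)`, obtained from signature shares, from the
  sender, or from the triggers of a delivered message. -/
  | process (p : Fin n) (m : Msg n α) (hp : p ∉ S.byz) (h : Certified S s m)
      (hφ : S.φ ≤ m.round) :
      Step { s with
        processed := insert (p, m) s.processed
        triggers := fun q i =>
          if q = p ∧ i = m.sender ∧ ∀ x, s.triggers p i = some x → x.round < m.round
          then some m else s.triggers q i }
  /-- `p` calls `Deliver` on `y`. -/
  | deliver (p : Fin n) (ρ : Rule) (y : Msg n α) (hp : p ∉ S.byz) (h : MayDeliver S s p ρ y) :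
      Step { s with delivered := insert (p, ρ, y) s.delivered }

end Protocol

section Runs

variable {n : ℕ} {α : Type u} (S : Setup n) (run : ℕ → State n α)

/-- An execution (idle steps are allowed, so that finite executions are included). -/
def IsRun : Prop :=
  run 0 = State.init n α ∧ ∀ t, run (t + 1) = run t ∨ Step S (run t) (run (t + 1))

/-- Agreement for sender `j` and the delivery rules in `R`: what an honest node delivers by a rule
in `R` never differs from what an honest node delivers, by whatever rule and at whatever time, for
the same sender and round. -/
def Agreement (j : Fin n) (R : Set Rule) : Prop :=
  ∀ (p q : Fin n) (t t' : ℕ) (ρ ρ' : Rule) (m m' : Msg n α), p ∉ S.byz → q ∉ S.byz → ρ ∈ R →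
    (p, ρ, m) ∈ (run t).delivered → (q, ρ', m') ∈ (run t').delivered →
    m.sender = j → m'.sender = j → m.round = m'.round → m = m'

/-- Whenever the optimistic condition holds for a message `x` of sender `j`, the causal chain of
`x` has a message `y` in every round `u` from that of `x` down to `1`; every honest node may deliver
`y` by the optimistic rule, and no honest node ever delivers, by whatever rule, another message of
`j` for round `u`. -/
def ChainSafe (j : Fin n) : Prop :=
  ∀ (t r : ℕ) (x : Msg n α), OptimisticCondition S (run t) r x → x.sender = j →
    ∀ u, 1 ≤ u → u ≤ x.round →
      ∃ y, Chain S (run t) x y ∧ y.sender = j ∧ y.round = u ∧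
        (∀ p, p ∉ S.byz → MayDeliver S (run t) p .optimistic y) ∧
        ∀ (q : Fin n) (t' : ℕ) (ρ : Rule) (y' : Msg n α), q ∉ S.byz →
          (q, ρ, y') ∈ (run t').delivered → y'.sender = j → y'.round = u → y' = y

/-- Every committee of sender `j` has a majority of honest nodes. -/
def HonestMajority (j : Fin n) : Prop :=
  ∀ a < S.φ, S.nc < 2 * (S.slot j a \ S.byz).card

/-- Along every certified chain of sender `j` from a round `r` to round `r + φ`, at least `f+1`
distinct honest nodes sign at least one of the messages in the `φ` rounds after `r`. -/
def HonestSigners (j : Fin n) : Prop :=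
  ∀ (t : ℕ) (top x : Msg n α), top.sender = j → Certified S (run t) top → top ∈ (run t).msgs →
    Chain S (run t) top x → x.round + S.φ = top.round →
    ∃ K : Finset (Fin n), S.f + 1 ≤ K.card ∧ ∀ k ∈ K, k ∉ S.byz ∧
      ∃ (t' : ℕ) (z : Msg n α), Chain S (run t) top z ∧ Chain S (run t) z x ∧ x.round < z.round ∧
        (k, z) ∈ (run t').shares

end Runs

/-- Each of the `φ` random committees of each sender is a uniformly random set of `nc` nodes. -/
def UniformCommittees {Ω : Type*} [MeasurableSpace Ω] (μ : Measure Ω) {n : ℕ} (φ nc : ℕ)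
    (C : Ω → Fin n → ℕ → Finset (Fin n)) : Prop :=
  ∀ (i : Fin n) (a : ℕ), a < φ → (∀ ω, (C ω i a).card = nc) ∧
    ∀ T : Finset (Fin n), T.card = nc →
      MeasurableSet {ω | C ω i a = T} ∧ μ {ω | C ω i a = T} = ((n.choose nc : ℕ) : ENNReal)⁻¹

end APMBRB

/-! Safety rests on `promises` being write-once: two messages of one sender and round that the same
honest node has promised, at whatever times, are equal. Agreement therefore reduces to finding one
honest node that has promised both delivered messages.

An honest node puts a certificate into `prev`, or signs on top of it, only if it has promised the
certified message, and promises are closed under parents. Hence an optimistic delivery is promised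
by all honest nodes, and a quorum delivery by the honest members of a set of `2f+1` nodes. If
committees have honest majorities, a delivery by Condition 1 is promised by an honest signer of the
top certificate (`Inv.exists_promise_of_delivered`). Optimistic deliveries thus share an honest
promiser with every delivery. For the quorum rule, `f+1` honest promisers of the other message are
needed, since they meet any `2f+1` of the `3f+1` nodes (`IsRun.agreement_quorum`).

All of this is deterministic once the committees of the sender have honest majorities. Part 1 bounds
the failure of that event by a Chernoff bound for the hypergeometric distribution (`card_bad_le`)
and a union bound over the `φ` residues. -/

namespace APMBRB

/-! ### Monotonicity and invariants of reachable states -/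

section Invariants

variable {n : ℕ} {α : Type*} {S : Setup n} {s s' : State n α}

/-- `s'` extends `s`: networks and logs only grow, and promises are never overwritten. -/
structure Grows (s s' : State n α) : Prop where
  msgs : s.msgs ⊆ s'.msgs
  shares : s.shares ⊆ s'.shares
  processed : s.processed ⊆ s'.processed
  delivered : s.delivered ⊆ s'.delivered
  promises : ∀ p i r m, s.promises p i r = some m → s'.promises p i r = some m

theorem Grows.refl (s : State n α) : Grows s s :=
  ⟨subset_rfl, subset_rfl, subset_rfl, subset_rfl, fun _ _ _ _ h => h⟩

theorem Grows.trans {s'' : State n α} (h : Grows s s') (h' : Grows s' s'') : Grows s s'' :=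
  ⟨h.msgs.trans h'.msgs, h.shares.trans h'.shares, h.processed.trans h'.processed,
    h.delivered.trans h'.delivered, fun _ _ _ _ e => h'.promises _ _ _ _ (h.promises _ _ _ _ e)⟩

theorem Step.grows (h : Step S s s') : Grows s s' := by
  cases h with
  | promise p m hp hm hnew h =>
    refine ⟨subset_rfl, subset_rfl, subset_rfl, subset_rfl, fun q i r x hx => ?_⟩
    dsimp only
    split_ifs with hc
    · obtain ⟨rfl, rfl, rfl⟩ := hc
      rw [hnew] at hx
      cases hx
    · exact hx
  | _ =>
    constructor
    all_goals first
      | exact fun _ _ _ _ h => h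
      | exact subset_rfl
      | exact Set.subset_insert _ _

theorem Certified.mono (h : Grows s s') {m : Msg n α} : Certified S s m → Certified S s' m :=
  fun ⟨K, hK, hc, hs⟩ => ⟨K, hK, hc, fun k hk => h.shares (hs k hk)⟩

theorem Extends.mono (h : Grows s s') {x y : Msg n α} : Extends S s x y → Extends S s' x y :=
  fun ⟨h1, h2, h3, h4, h5⟩ => ⟨h1, h2, h3, h4.mono h, h.msgs h5⟩

theorem Chain.mono (h : Grows s s') {x y : Msg n α} : Chain S s x y → Chain S s' x y :=
  fun hc => Relation.ReflTransGen.mono (fun _ _ => Extends.mono h) _ _ hc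

theorem ExtendsPromise.mono (h : Grows s s') {p : Fin n} {m : Msg n α} :
    ExtendsPromise S s p m → ExtendsPromise S s' p m
  | .inl h1 => .inl h1
  | .inr ⟨x, h1, h2, h3, h4⟩ => .inr ⟨x, h1, h2, h.promises _ _ _ _ h3, h4.mono h⟩

theorem MayDeliver.mono (h : Grows s s') {p : Fin n} {ρ : Rule} {y : Msg n α} :
    MayDeliver S s p ρ y → MayDeliver S s' p ρ y := by
  cases ρ with
  | certChain =>
    rintro ⟨top, h1, h2, h3, h4, h5⟩
    exact ⟨top, h.processed h1, h.msgs h2, h3.mono h, h4, h5⟩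
  | optimistic =>
    rintro ⟨r, x, ⟨hr, M, hM⟩, h2, h3, h4, h5⟩
    refine ⟨r, x, ⟨hr, M, fun k => ?_⟩, h2.mono h, h.msgs h3, h4.mono h, h5⟩
    obtain ⟨a, b, c, d, e⟩ := hM k
    exact ⟨a, b, h.msgs c, d.mono h, e⟩
  | quorum =>
    rintro ⟨r, x, ⟨hr, Q, M, hQ, hM⟩, h2, h3, h4, h5⟩
    refine ⟨r, x, ⟨hr, Q, M, hQ, fun k hk => ?_⟩, h2.mono h, h.msgs h3, h4.mono h, h5⟩
    obtain ⟨a, b, ⟨ρ, c⟩, d⟩ := hM k hk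
    exact ⟨a, b, ⟨ρ, h.delivered c⟩, d⟩

/-- What holds in every reachable state. -/
structure Inv (S : Setup n) (s : State n α) : Prop where
  mayDeliver : ∀ p ρ y, (p, ρ, y) ∈ s.delivered → MayDeliver S s p ρ y
  certified : ∀ p m, (p, m) ∈ s.processed → Certified S s m
  signed : ∀ k m, (k, m) ∈ s.shares → k ∉ S.byz → ExtendsPromise S s k m
  promised : ∀ p i r m, s.promises p i r = some m →
    m.sender = i ∧ m.round = r ∧ m ∈ s.msgs ∧ ExtendsPromise S s p m
  prev : ∀ m ∈ s.msgs, m.sender ∉ S.byz → ∀ y ∈ m.prev,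
    s.promises m.sender y.sender y.round = some y ∧ Certified S s y

theorem Inv.init : Inv S (State.init n α) := by
  constructor <;> simp [State.init]

/-- Every clause persists under `Grows`, so each needs checking only for the steps that can create a
new item of its kind. -/
theorem Inv.step (hI : Inv S s) (h : Step S s s') : Inv S s' := by
  have hg := h.grows
  refine ⟨fun p ρ y hy => ?_, fun p m hm => ?_, fun k m hm hk => ?_, fun p i r m hm => ?_,
    fun m hm hb y hy => ?_⟩
  · by_cases hold : (p, ρ, y) ∈ s.delivered
    · exact (hI.mayDeliver _ _ _ hold).mono hg
    · cases h with
      | deliver q ρ' y' hq h =>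
        rcases hy with hy | hy
        · cases hy
          exact h.mono hg
        · exact absurd hy hold
      | _ => exact absurd hy hold
  · by_cases hold : (p, m) ∈ s.processed
    · exact (hI.certified _ _ hold).mono hg
    · cases h with
      | process q m' hq h hφ =>
        rcases hm with hm | hm
        · cases hm
          exact h.mono hg
        · exact absurd hm hold
      | _ => exact absurd hm hold
  · by_cases hold : (k, m) ∈ s.shares
    · exact (hI.signed _ _ hold hk).mono hg
    · cases h with
      | byzShare k' m' h =>
        rcases hm with hm | hm
        · cases hm
          exact absurd h hk
        · exact absurd hm hold
      | sign q m' hq hseen h =>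
        rcases hm with hm | hm
        · cases hm
          exact h.mono hg
        · exact absurd hm hold
      | _ => exact absurd hm hold
  · by_cases hold : s.promises p i r = some m
    · obtain ⟨h1, h2, h3, h4⟩ := hI.promised _ _ _ _ hold
      exact ⟨h1, h2, hg.msgs h3, h4.mono hg⟩
    · cases h with
      | promise q m' hq hm' hnew h =>
        dsimp only at hm
        split_ifs at hm with hc
        · obtain ⟨rfl, rfl, rfl⟩ := hc
          cases hm
          exact ⟨rfl, rfl, hm', h.mono hg⟩
        · exact absurd hm hold
      | _ => exact absurd hm hold
  · by_cases hold : m ∈ s.msgs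
    · obtain ⟨h1, h2⟩ := hI.prev m hold hb y hy
      exact ⟨hg.promises _ _ _ _ h1, h2.mono hg⟩
    · cases h with
      | byzMsg m' h =>
        rcases hm with rfl | hm
        · exact absurd h hb
        · exact absurd hm hold
      | send q m' hq h =>
        rcases hm with rfl | hm
        · obtain ⟨rfl, -, -, ⟨-, -, h0⟩ | ⟨r, x, -, -, -, -, J, -, hJ, hp⟩⟩ := h
          · simp [h0] at hy
          · obtain ⟨j, hj, hjy⟩ := (hp y).1 hy
            obtain ⟨h1, h2, -, -⟩ := hI.promised _ _ _ _ hjy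
            obtain ⟨y', hy', hc⟩ := hJ j hj
            rw [hjy] at hy'
            cases hy'
            subst h1 h2
            exact ⟨hg.promises _ _ _ _ hjy, hc.mono hg⟩
        · exact absurd hm hold
      | _ => exact absurd hm hold

theorem IsRun.inv {run : ℕ → State n α} (h : IsRun S run) (t : ℕ) : Inv S (run t) := by
  induction t with
  | zero => rw [h.1]; exact Inv.init
  | succ t ih =>
    rcases h.2 t with e | hs
    · rwa [e]
    · exact ih.step hs

theorem IsRun.grows {run : ℕ → State n α} (h : IsRun S run) {t t' : ℕ} (ht : t ≤ t') :
    Grows (run t) (run t') := by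
  induction t', ht using Nat.le_induction with
  | base => exact Grows.refl _
  | succ t' _ ih =>
    rcases h.2 t' with e | hs
    · rwa [e]
    · exact ih.trans hs.grows

theorem Chain.sender_eq {x y : Msg n α} (h : Chain S s x y) : y.sender = x.sender := by
  induction h with
  | refl => rfl
  | tail _ e ih => exact e.2.1.trans ih

theorem Chain.round_le {x y : Msg n α} (h : Chain S s x y) : y.round ≤ x.round := by
  induction h with
  | refl => exact le_rfl
  | tail _ e ih => have := e.2.2.1; omega

/-- All messages of the causal chain of a certified message are certified and available. -/
theorem Chain.certified {x y : Msg n α} (h : Chain S s x y) (hx : Certified S s x)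
    (hx' : x ∈ s.msgs) : Certified S s y ∧ y ∈ s.msgs := by
  cases h with
  | refl => exact ⟨hx, hx'⟩
  | tail _ e => exact ⟨e.2.2.2.1, e.2.2.2.2⟩

/-- Rounds drop by exactly one per step of a chain, so no round is skipped. -/
theorem Chain.exists_between {x y : Msg n α} (h : Chain S s x y) {r : ℕ} (hy : y.round ≤ r)
    (hx : r ≤ x.round) : ∃ z, Chain S s x z ∧ Chain S s z y ∧ z.round = r := by
  induction h with
  | refl => exact ⟨x, .refl, .refl, le_antisymm hy hx⟩
  | @tail b c hb e ih =>
    rcases hy.eq_or_lt with h | h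
    · exact ⟨c, hb.tail e, .refl, h⟩
    · have := e.2.2.1
      obtain ⟨z, h1, h2, h3⟩ := ih (by omega)
      exact ⟨z, h1, h2.tail e, h3⟩

/-- Promises are closed under parents, whatever the state in which the chain is read off. -/
theorem Inv.promise_of_chain (hI : Inv S s) {p : Fin n} {x y : Msg n α}
    (hx : s.promises p x.sender x.round = some x) (h : Chain S s' x y) (hy : 1 ≤ y.round) :
    s.promises p x.sender y.round = some y := by
  induction h with
  | refl => exact hx
  | @tail b c hb e ih =>
    have hr := e.2.2.1
    -- `b` lies above round `1`, so it was accepted because its parent was the entry one round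
    -- below. The parent is a field of `b`, hence equals `c` in any state.
    obtain ⟨hbs, -, -, h1 | ⟨w, hw, -, hp, -⟩⟩ := hI.promised _ _ _ _ (ih (by omega))
    · omega
    · rw [e.1] at hw
      cases hw
      rwa [hbs] at hp

/-- An honest signer of a message has promised all its proper ancestors. -/
theorem Inv.promise_of_signed (hI : Inv S s) {k : Fin n} {z y : Msg n α} (hk : k ∉ S.byz)
    (hs : (k, z) ∈ s.shares) (h : Chain S s' z y) (hy : 1 ≤ y.round) (hlt : y.round < z.round) :
    s.promises k z.sender y.round = some y := by
  -- Signing `z` guarantees a promise of its parent `w` only, not of `z`; this is why `y` must lie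
  -- strictly below `z`.
  rcases Relation.ReflTransGen.cases_head h with rfl | ⟨w, e, hw⟩
  · omega
  · rcases hI.signed k z hs hk with h1 | ⟨w', hw', -, hp, -⟩
    · have := e.2.2.1
      have := Chain.round_le hw
      omega
    · rw [e.1] at hw'
      cases hw'
      rw [← e.2.1] at hp ⊢
      exact hI.promise_of_chain hp hw hy

/-- The chain of promises from a promised message down to round `1`. -/
theorem Inv.exists_chain (hI : Inv S s) {p i : Fin n} {u : ℕ} (hu : 1 ≤ u) :
    ∀ (d : ℕ) (x : Msg n α), s.promises p i (u + d) = some x →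
      ∃ y, Chain S s x y ∧ y.sender = i ∧ y.round = u
  | 0, x, hx => ⟨x, .refl, (hI.promised _ _ _ _ hx).1, (hI.promised _ _ _ _ hx).2.1⟩
  | d + 1, x, hx => by
    obtain ⟨hs, hr, -, h1 | ⟨w, hw, hwr, hp, hc⟩⟩ := hI.promised _ _ _ _ hx
    · omega
    · obtain ⟨hws, -, hwm, -⟩ := hI.promised _ _ _ _ hp
      have hwd : w.round = u + d := by omega
      rw [hs, hwd] at hp
      obtain ⟨y, hy, hy'⟩ := hI.exists_chain hu d w hp
      exact ⟨y, .head ⟨hw, hws, hwr, hc, hwm⟩ hy, hy'⟩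

/-- With more than half of the committee honest, its corrupted members are too few to reach the
threshold `nc / 2 + 1`. -/
theorem Certified.exists_honest {j : Fin n} (hφ : 1 ≤ S.φ)
    (hcard : ∀ a < S.φ, (S.slot j a).card = S.nc) (hmaj : HonestMajority S j) {m : Msg n α}
    (hm : Certified S s m) (hj : m.sender = j) : ∃ k, k ∉ S.byz ∧ (k, m) ∈ s.shares := by
  obtain ⟨K, hK, hKc, hKs⟩ := hm
  have ha : m.round % S.φ < S.φ := Nat.mod_lt _ hφ
  rw [hj, Setup.committee] at hK
  by_contra! hcon
  have hKb : K ⊆ S.slot j (m.round % S.φ) ∩ S.byz := fun k hk =>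
    Finset.mem_inter.2 ⟨hK hk, by_contra fun hb => hcon k hb (hKs k hk)⟩
  have h1 := Finset.card_le_card hKb
  have h2 := Finset.card_sdiff_add_card_inter (S.slot j (m.round % S.φ)) S.byz
  have h3 := hmaj _ ha
  have h4 := hcard _ ha
  omega

/-- The condition covers the messages of all nodes, in particular that of `k`, and an honest `k`
lists only its own promises in `prev`. -/
theorem Inv.promise_of_optimistic (hI : Inv S s) {r : ℕ} {x : Msg n α}
    (h : OptimisticCondition S s r x) {k : Fin n} (hk : k ∉ S.byz) :
    s.promises k x.sender x.round = some x ∧ Certified S s x := by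
  obtain ⟨-, M, hM⟩ := h
  obtain ⟨h1, -, h3, -, h5⟩ := hM k
  have := hI.prev (M k) h3 (by rwa [h1]) x h5
  rwa [h1] at this

theorem Inv.mem_msgs_of_delivered (hI : Inv S s) {p : Fin n} {ρ : Rule} {y : Msg n α}
    (h : (p, ρ, y) ∈ s.delivered) : y ∈ s.msgs := by
  have hm := hI.mayDeliver _ _ _ h
  cases ρ with
  | certChain =>
    obtain ⟨top, h1, h2, h3, -⟩ := hm
    exact (h3.certified (hI.certified _ _ h1) h2).2
  | optimistic =>
    obtain ⟨-, x, -, h1, h2, h3, -⟩ := hm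
    exact (h3.certified h1 h2).2
  | quorum =>
    obtain ⟨-, x, -, h1, h2, h3, -⟩ := hm
    exact (h3.certified h1 h2).2

/-- The honest members of the quorum of the second rule have promised the message. -/
theorem Inv.promise_of_quorum (hI : Inv S s) {p : Fin n} {r : ℕ} {x : Msg n α}
    (h : QuorumCondition S s p r x) : ∃ Q : Finset (Fin n), Q.card = 2 * S.f + 1 ∧
      ∀ k ∈ Q, k ∉ S.byz → s.promises k x.sender x.round = some x := by
  obtain ⟨-, Q, M, hQ, hM⟩ := h
  refine ⟨Q, hQ, fun k hk hb => ?_⟩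
  obtain ⟨h1, -, ⟨ρ, h3⟩, h4⟩ := hM k hk
  have := (hI.prev (M k) (hI.mem_msgs_of_delivered h3) (by rwa [h1]) x h4).1
  rwa [h1] at this

end Invariants

/-! ### Agreement from common honest promisers -/

section Safety

variable {n : ℕ} {α : Type*} {S : Setup n} {s : State n α}

theorem Inv.promise_of_delivered_optimistic (hI : Inv S s) {p : Fin n} {y : Msg n α}
    (h : (p, Rule.optimistic, y) ∈ s.delivered) {k : Fin n} (hk : k ∉ S.byz) :
    s.promises k y.sender y.round = some y := by
  obtain ⟨r, x, h1, -, -, h4, h5⟩ := hI.mayDeliver _ _ _ h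
  rw [h4.sender_eq]
  exact hI.promise_of_chain (hI.promise_of_optimistic h1 hk).1 h4 h5

theorem Inv.promise_of_delivered_quorum (hI : Inv S s) {p : Fin n} {y : Msg n α}
    (h : (p, Rule.quorum, y) ∈ s.delivered) : ∃ Q : Finset (Fin n), Q.card = 2 * S.f + 1 ∧
      ∀ k ∈ Q, k ∉ S.byz → s.promises k y.sender y.round = some y := by
  obtain ⟨r, x, h1, -, -, h4, h5⟩ := hI.mayDeliver _ _ _ h
  obtain ⟨Q, hQ, hp⟩ := hI.promise_of_quorum h1
  refine ⟨Q, hQ, fun k hk hb => ?_⟩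
  rw [h4.sender_eq]
  exact hI.promise_of_chain (hp k hk hb) h4 h5

/-- With honest majorities, whatever is delivered has been promised by some honest node. -/
theorem Inv.exists_promise_of_delivered (hI : Inv S s) {j : Fin n} (hφ : 1 ≤ S.φ)
    (hcard : ∀ a < S.φ, (S.slot j a).card = S.nc) (hmaj : HonestMajority S j)
    (hbyz : S.byz.card ≤ S.f) {p : Fin n} (hp : p ∉ S.byz) {ρ : Rule} {y : Msg n α}
    (h : (p, ρ, y) ∈ s.delivered) (hj : y.sender = j) :
    ∃ k, k ∉ S.byz ∧ s.promises k y.sender y.round = some y := by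
  cases ρ with
  | certChain =>
    obtain ⟨top, h1, h2, h3, h4, h5⟩ := hI.mayDeliver _ _ _ h
    have hs := h3.sender_eq
    obtain ⟨k, hk, hsh⟩ := (hI.certified _ _ h1).exists_honest hφ hcard hmaj (hs ▸ hj)
    rw [hs]
    -- `1 ≤ φ` places `y` strictly below the certified `top`.
    exact ⟨k, hk, hI.promise_of_signed hk hsh h3 h4 (by omega)⟩
  | optimistic => exact ⟨p, hp, hI.promise_of_delivered_optimistic h hp⟩
  | quorum =>
    obtain ⟨Q, hQ, hQp⟩ := hI.promise_of_delivered_quorum h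
    obtain ⟨k, hk, hb⟩ := Finset.exists_mem_notMem_of_card_lt_card
      (show S.byz.card < Q.card by omega)
    exact ⟨k, hb, hQp k hk hb⟩

variable {run : ℕ → State n α} {j : Fin n}

/-- Some honest node has promised `y'` and, by `hy`, also `y`. Both entries survive to time `max t
t'`, where they occupy the same cell. -/
theorem IsRun.delivered_eq_of_promised (hrun : IsRun S run) (hφ : 1 ≤ S.φ)
    (hcard : ∀ a < S.φ, (S.slot j a).card = S.nc) (hmaj : HonestMajority S j)
    (hbyz : S.byz.card ≤ S.f) {t t' : ℕ} {y y' : Msg n α}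
    (hy : ∀ k, k ∉ S.byz → (run t).promises k j y.round = some y) {q : Fin n} (hq : q ∉ S.byz)
    {ρ : Rule} (h : (q, ρ, y') ∈ (run t').delivered) (hj : y'.sender = j)
    (hr : y'.round = y.round) : y' = y := by
  obtain ⟨k, hk, hp⟩ :=
    (hrun.inv t').exists_promise_of_delivered hφ hcard hmaj hbyz hq h hj
  have h1 := (hrun.grows (le_max_left t t')).promises _ _ _ _ (hy k hk)
  have h2 := (hrun.grows (le_max_right t t')).promises _ _ _ _ hp
  rw [hj, hr, h1] at h2
  exact (Option.some.inj h2).symm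

theorem IsRun.agreement_optimistic (hrun : IsRun S run) (hφ : 1 ≤ S.φ)
    (hcard : ∀ a < S.φ, (S.slot j a).card = S.nc) (hmaj : HonestMajority S j)
    (hbyz : S.byz.card ≤ S.f) : Agreement S run j {Rule.optimistic} := by
  rintro p q t t' ρ ρ' m m' - hq rfl hm hm' hj hj' hr
  refine (hrun.delivered_eq_of_promised hφ hcard hmaj hbyz (t := t) (fun k hk => ?_) hq hm' hj'
    hr.symm).symm
  rw [← hj]
  exact (hrun.inv t).promise_of_delivered_optimistic hm hk

theorem IsRun.chainSafe (hrun : IsRun S run) (hφ : 1 ≤ S.φ)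
    (hcard : ∀ a < S.φ, (S.slot j a).card = S.nc) (hmaj : HonestMajority S j)
    (hbyz : S.byz.card ≤ S.f) (hn : S.f < n) : ChainSafe S run j := by
  rintro t r x hx rfl u hu hux
  have hI := hrun.inv t
  have hpx : ∀ k, k ∉ S.byz → (run t).promises k x.sender x.round = some x := fun k hk =>
    (hI.promise_of_optimistic hx hk).1
  -- The chain is read off from the promises of one honest node; parent closure then makes its
  -- messages promises of every honest node.
  obtain ⟨k, -, hk⟩ := Finset.exists_mem_notMem_of_card_lt_card
    (show S.byz.card < (Finset.univ : Finset (Fin n)).card by simp; omega)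
  obtain ⟨y, hxy, hys, rfl⟩ := hI.exists_chain hu (x.round - u) x
    (by rw [Nat.add_sub_cancel' hux]; exact hpx k hk)
  refine ⟨y, hxy, hys, rfl, fun p hp => ⟨r, x, hx, (hI.promise_of_optimistic hx hk).2,
    (hI.promised _ _ _ _ (hpx k hk)).2.2.1, hxy, hu⟩, fun q t' ρ y' hq hd hs hr => ?_⟩
  exact hrun.delivered_eq_of_promised hφ hcard hmaj hbyz
    (fun k hk => hI.promise_of_chain (hpx k hk) hxy hu) hq hd hs hr

/-- Among `3f+1` nodes, a quorum of `2f+1` and `f+1` honest nodes have an honest node in common. -/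
theorem exists_common_honest {f : ℕ} (hn : n = 3 * f + 1) {B Q K : Finset (Fin n)}
    (hQ : Q.card = 2 * f + 1) (hK : f + 1 ≤ K.card) (hKB : ∀ k ∈ K, k ∉ B) :
    ∃ k ∈ Q, k ∈ K ∧ k ∉ B := by
  have h := Finset.card_union_add_card_inter Q K
  have h' := Finset.card_le_univ (Q ∪ K)
  rw [Fintype.card_fin] at h'
  -- `(2f+1) + (f+1) = 3f+2` exceeds the number of nodes.
  obtain ⟨k, hk⟩ := Finset.card_pos.1 (show 0 < (Q ∩ K).card by omega)
  rw [Finset.mem_inter] at hk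
  exact ⟨k, hk.1, hk.2, hKB k hk.2⟩

theorem IsRun.exists_signers_promise (hrun : IsRun S run)
    (hsig : HonestSigners S run j) {t : ℕ} {p : Fin n} {y : Msg n α}
    (h : (p, Rule.certChain, y) ∈ (run t).delivered) (hj : y.sender = j) :
    ∃ K : Finset (Fin n), S.f + 1 ≤ K.card ∧ ∀ k ∈ K, k ∉ S.byz ∧
      ∃ t', (run t').promises k j y.round = some y := by
  have hI := hrun.inv t
  obtain ⟨top, h1, h2, h3, h4, h5⟩ := hI.mayDeliver _ _ _ h
  -- `HonestSigners` speaks of chains of length exactly `φ`, so the chain is cut at `w`, `φ` rounds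
  -- above `y`. Each signer it yields signed strictly above `y` and so has promised `y`, possibly at
  -- its own time.
  obtain ⟨w, hw1, hw2, hwr⟩ := h3.exists_between (Nat.le_add_right _ _) h5
  obtain ⟨hwc, hwm⟩ := hw1.certified (hI.certified _ _ h1) h2
  have hwj : w.sender = j := hw2.sender_eq.symm.trans hj
  obtain ⟨K, hK, hKs⟩ := hsig t w y hwj hwc hwm hw2 hwr.symm
  refine ⟨K, hK, fun k hk => ?_⟩
  obtain ⟨hb, t', z, -, hzy, hlt, hsh⟩ := hKs k hk
  refine ⟨hb, t', ?_⟩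
  rw [← hj, hzy.sender_eq]
  exact (hrun.inv t').promise_of_signed hb hsh hzy h4 hlt

theorem IsRun.agreement_quorum (hrun : IsRun S run) (hφ : 1 ≤ S.φ)
    (hcard : ∀ a < S.φ, (S.slot j a).card = S.nc) (hmaj : HonestMajority S j)
    (hsig : HonestSigners S run j) (hbyz : S.byz.card ≤ S.f) (hn : n = 3 * S.f + 1) :
    Agreement S run j {Rule.optimistic, Rule.quorum} := by
  rintro p q t t' ρ ρ' m m' hp hq hρ hm hm' hj hj' hr
  rcases hρ with rfl | rfl
  · exact hrun.agreement_optimistic hφ hcard hmaj hbyz p q t t' _ ρ' m m' hp hq rfl hm hm' hj hj' hr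
  obtain ⟨Q, hQ, hQp⟩ := (hrun.inv t).promise_of_delivered_quorum hm
  -- It is enough that `f+1` honest nodes promised `m'`: one of them lies in the quorum behind `m`.
  suffices ∃ K : Finset (Fin n), S.f + 1 ≤ K.card ∧ ∀ k ∈ K, k ∉ S.byz ∧
      ∃ t₁, (run t₁).promises k j m'.round = some m' by
    obtain ⟨K, hK, hKp⟩ := this
    obtain ⟨k, hkQ, hkK, hkb⟩ := exists_common_honest hn hQ hK fun k hk => (hKp k hk).1
    obtain ⟨-, t₁, hk'⟩ := hKp k hkK
    have h1 := (hrun.grows (le_max_left t t₁)).promises _ _ _ _ (hQp k hkQ hkb)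
    have h2 := (hrun.grows (le_max_right t t₁)).promises _ _ _ _ hk'
    rw [hj, hr, h2] at h1
    exact (Option.some.inj h1).symm
  cases ρ' with
  | certChain => exact hrun.exists_signers_promise hsig hm' hj'
  | optimistic =>
    refine ⟨Finset.univ \ S.byz, ?_, fun k hk => ?_⟩
    · have := Finset.le_card_sdiff S.byz Finset.univ
      rw [Finset.card_univ, Fintype.card_fin] at this
      omega
    · have hk' := (Finset.mem_sdiff.1 hk).2
      exact ⟨hk', t', hj' ▸ (hrun.inv t').promise_of_delivered_optimistic hm' hk'⟩
  | quorum =>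
    obtain ⟨Q', hQ', hQp'⟩ := (hrun.inv t').promise_of_delivered_quorum hm'
    -- Removing at most `f` corrupted nodes from `2f+1` leaves at least `f+1`.
    refine ⟨Q' \ S.byz, ?_, fun k hk => ?_⟩
    · have := Finset.le_card_sdiff S.byz Q'
      omega
    · obtain ⟨hk1, hk2⟩ := Finset.mem_sdiff.1 hk
      exact ⟨hk2, t', hj' ▸ hQp' k hk1 hk2⟩

end Safety

/-! ### Hypergeometric tail bound for the committees -/

section Sampling

/-- The comparison is factor by factor: `3 * (b - j) ≤ n - j`, also when the subtraction truncates.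
-/
theorem three_pow_mul_descFactorial_le {b n : ℕ} (h : 3 * b ≤ n) (j : ℕ) :
    3 ^ j * b.descFactorial j ≤ n.descFactorial j := by
  induction j with
  | zero => simp
  | succ j ih =>
    rw [Nat.descFactorial_succ, Nat.descFactorial_succ]
    calc 3 ^ (j + 1) * ((b - j) * b.descFactorial j)
        = (3 * (b - j)) * (3 ^ j * b.descFactorial j) := by ring
      _ ≤ _ := Nat.mul_le_mul (by omega) ih

theorem three_pow_mul_choose_le {b n : ℕ} (h : 3 * b ≤ n) (j : ℕ) :
    3 ^ j * b.choose j ≤ n.choose j := by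
  have := three_pow_mul_descFactorial_le h j
  rw [Nat.descFactorial_eq_factorial_mul_choose, Nat.descFactorial_eq_factorial_mul_choose,
    mul_left_comm] at this
  exact Nat.le_of_mul_le_mul_left this (Nat.factorial_pos j)

variable {n : ℕ}

/-- Removing `U` is injective on the supersets of `U`. For `U.card > k` the truncated right side is
`1`, too weak for the sum below, where that case is set to `0` separately. -/
theorem card_supersets_le (k : ℕ) (U : Finset (Fin n)) :
    ((Finset.powersetCard k Finset.univ).filter (U ⊆ ·)).card ≤ (n - U.card).choose (k - U.card) := by
  have hc : (Finset.powersetCard (k - U.card) Uᶜ).card = (n - U.card).choose (k - U.card) := by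
    rw [Finset.card_powersetCard, Finset.card_compl, Fintype.card_fin]
  rw [← hc]
  refine Finset.card_le_card_of_injOn (· \ U) (fun T hT => ?_) fun T hT T' hT' h => ?_
  · simp only [Finset.coe_filter, Finset.mem_powersetCard_univ, Set.mem_ofPred_eq] at hT
    simp only [Finset.mem_coe, Finset.mem_powersetCard]
    refine ⟨fun x hx => by simpa using (Finset.mem_sdiff.1 hx).2, ?_⟩
    rw [Finset.card_sdiff_of_subset hT.2, hT.1]
  · simp only [Finset.coe_filter, Set.mem_ofPred_eq] at hT hT'
    rw [← Finset.sdiff_union_of_subset hT.2, ← Finset.sdiff_union_of_subset hT'.2]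
    exact congrArg (· ∪ U) h

/-- A bound for the moment generating function of the hypergeometric distribution. -/
theorem sum_two_pow_card_inter_le (k : ℕ) (B : Finset (Fin n)) (hB : 3 * B.card ≤ n) :
    ∑ T ∈ Finset.powersetCard k (Finset.univ : Finset (Fin n)), (2 : ℝ) ^ (T ∩ B).card ≤
      n.choose k * (4 / 3) ^ k := by
  have hterm : ∀ U ∈ B.powerset,
      ((Finset.powersetCard k (Finset.univ : Finset (Fin n))).filter (U ⊆ ·)).card ≤
        if U.card ≤ k then (n - U.card).choose (k - U.card) else 0 := by
    intro U _
    split_ifs with h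
    · exact card_supersets_le k U
    · rw [Nat.le_zero, Finset.card_eq_zero, Finset.filter_eq_empty_iff]
      intro T hT hUT
      have := Finset.card_le_card hUT
      rw [Finset.mem_powersetCard_univ] at hT
      omega
  -- `2 ^ (T ∩ B).card` counts the subsets `U` of `B` contained in `T`; the sums over `T` and `U`
  -- are exchanged and the sets `U` grouped by size.
  have hcount : ∑ T ∈ Finset.powersetCard k (Finset.univ : Finset (Fin n)), 2 ^ (T ∩ B).card ≤
      ∑ j ∈ Finset.range (k + 1), B.card.choose j * (n - j).choose (k - j) := by
    calc ∑ T ∈ Finset.powersetCard k (Finset.univ : Finset (Fin n)), 2 ^ (T ∩ B).card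
        = ∑ T ∈ Finset.powersetCard k (Finset.univ : Finset (Fin n)),
            (B.powerset.filter (· ⊆ T)).card := by
          refine Finset.sum_congr rfl fun T _ => ?_
          rw [← Finset.card_powerset]
          congr 1
          ext U
          simp only [Finset.mem_powerset, Finset.mem_filter, Finset.subset_inter_iff, and_comm]
      _ = ∑ U ∈ B.powerset,
            ((Finset.powersetCard k (Finset.univ : Finset (Fin n))).filter (U ⊆ ·)).card := by
          simp only [Finset.card_filter]
          exact Finset.sum_comm
      _ ≤ ∑ U ∈ B.powerset, if U.card ≤ k then (n - U.card).choose (k - U.card) else 0 :=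
          Finset.sum_le_sum hterm
      _ = ∑ j ∈ Finset.range (B.card + 1),
            B.card.choose j * if j ≤ k then (n - j).choose (k - j) else 0 := by
          rw [Finset.sum_powerset_apply_card
            (fun j => if j ≤ k then (n - j).choose (k - j) else 0)]
          simp
      _ = ∑ j ∈ (Finset.range (B.card + 1)).filter (· ≤ k),
            B.card.choose j * (n - j).choose (k - j) := by
          rw [Finset.sum_filter]
          exact Finset.sum_congr rfl fun j _ => by split_ifs <;> simp
      _ ≤ _ := Finset.sum_le_sum_of_subset fun j hj => by
          simp only [Finset.mem_filter, Finset.mem_range] at hj ⊢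
          omega
  -- This compares with sampling with replacement at rate `1/3`. The factor `1 ^ (k - j)` puts the
  -- terms in the form of `add_pow`, giving `(1/3 + 1) ^ k`.
  have hj : ∀ j ∈ Finset.range (k + 1), ((B.card.choose j * (n - j).choose (k - j) : ℕ) : ℝ) ≤
      n.choose k * ((1 / 3) ^ j * 1 ^ (k - j) * k.choose j) := by
    intro j hj
    have hjk : j ≤ k := Nat.lt_succ_iff.1 (Finset.mem_range.1 hj)
    by_cases hkn : k ≤ n
    · have h1 : 3 ^ j * (B.card.choose j * (n - j).choose (k - j)) ≤ n.choose k * k.choose j := by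
        rw [Nat.choose_mul hjk, ← mul_assoc]
        exact Nat.mul_le_mul_right _ (three_pow_mul_choose_le hB j)
      have h2 : (3 : ℝ) ^ j * ((B.card.choose j * (n - j).choose (k - j) : ℕ) : ℝ) ≤
          n.choose k * k.choose j := by exact_mod_cast h1
      have h3 : (0 : ℝ) < 3 ^ j := by positivity
      rw [one_pow, mul_one, one_div, inv_pow, ← mul_assoc, mul_right_comm, ← div_eq_mul_inv,
        le_div_iff₀ h3, mul_comm]
      exact h2
    · rw [Nat.choose_eq_zero_of_lt (show n < k by omega)]
      by_cases hjn : j ≤ n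
      · rw [Nat.choose_eq_zero_of_lt (show n - j < k - j by omega)]
        simp
      · rw [Nat.choose_eq_zero_of_lt (show B.card < j by omega)]
        simp
  calc ∑ T ∈ Finset.powersetCard k (Finset.univ : Finset (Fin n)), (2 : ℝ) ^ (T ∩ B).card
      ≤ ((∑ j ∈ Finset.range (k + 1), B.card.choose j * (n - j).choose (k - j) : ℕ) : ℝ) := by
        exact_mod_cast hcount
    _ ≤ ∑ j ∈ Finset.range (k + 1), (n.choose k : ℝ) * ((1 / 3) ^ j * 1 ^ (k - j) * k.choose j) := by
        rw [Nat.cast_sum]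
        exact Finset.sum_le_sum hj
    _ = n.choose k * (4 / 3) ^ k := by
        rw [← Finset.mul_sum, ← add_pow]
        norm_num

/-- Hypergeometric tail bound: few sets of size `k` have half of their elements in `B`. -/
theorem card_bad_le (k : ℕ) (B : Finset (Fin n)) (hB : 3 * B.card ≤ n) :
    (((Finset.powersetCard k (Finset.univ : Finset (Fin n))).filter
      (fun T => k ≤ 2 * (T ∩ B).card)).card : ℝ) ≤ n.choose k * Real.exp (-(k / 18)) := by
  set F := (Finset.powersetCard k (Finset.univ : Finset (Fin n))).filter
    (fun T => k ≤ 2 * (T ∩ B).card)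
  have hs : (0 : ℝ) < √2 := by positivity
  -- Markov's inequality: on `F` the weight `2 ^ (T ∩ B).card` is at least `2 ^ (k/2)`, written `√2
  -- ^ k` to allow odd `k`.
  have h1 : (F.card : ℝ) * √2 ^ k ≤ n.choose k * (4 / 3) ^ k := by
    refine le_trans ?_ (sum_two_pow_card_inter_le k B hB)
    rw [← nsmul_eq_mul]
    refine (Finset.card_nsmul_le_sum F _ _ fun T hT => ?_).trans
      (Finset.sum_le_sum_of_subset_of_nonneg (Finset.filter_subset _ _) fun _ _ _ => by positivity)
    calc √2 ^ k ≤ √2 ^ (2 * (T ∩ B).card) :=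
          pow_le_pow_right₀ (Real.one_le_sqrt.2 (by norm_num)) (Finset.mem_filter.1 hT).2
      _ = 2 ^ (T ∩ B).card := by rw [pow_mul, Real.sq_sqrt (by norm_num)]
  -- Source of the constant `18`: squared, this is `8/9 ≤ exp (-1/9)`, an instance of `1 + x ≤ exp
  -- x`.
  have h2 : (4 / 3 : ℝ) ≤ √2 * Real.exp (-(1 / 18)) := by
    refine abs_le_of_sq_le_sq' ?_ (by positivity) |>.2
    rw [mul_pow, Real.sq_sqrt (by norm_num), ← Real.exp_nat_mul]
    have := Real.add_one_le_exp (-(1 / 9) : ℝ)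
    norm_num at this ⊢
    linarith
  have h3 : (4 / 3 : ℝ) ^ k ≤ Real.exp (-(k / 18)) * √2 ^ k := by
    refine (pow_le_pow_left₀ (by norm_num) h2 k).trans_eq ?_
    rw [mul_pow, ← Real.exp_nat_mul, mul_comm]
    congr 2
    ring
  refine le_of_mul_le_mul_right (h1.trans ?_) (pow_pos hs k)
  rw [mul_assoc]
  exact mul_le_mul_of_nonneg_left h3 (Nat.cast_nonneg _)

variable {Ω : Type*} [MeasurableSpace Ω] {μ : Measure Ω} [IsProbabilityMeasure μ]

theorem UniformCommittees.measure_slot_le {φ k : ℕ} {C : Ω → Fin n → ℕ → Finset (Fin n)}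
    (hC : UniformCommittees μ φ k C) (B : Finset (Fin n)) (hB : 3 * B.card ≤ n) (j : Fin n)
    {a : ℕ} (ha : a < φ) :
    μ {ω | 2 * (C ω j a \ B).card ≤ k} ≤ ENNReal.ofReal (Real.exp (-(k / 18))) := by
  obtain ⟨hcard, hunif⟩ := hC j a ha
  set F := (Finset.powersetCard k (Finset.univ : Finset (Fin n))).filter
    (fun T => k ≤ 2 * (T ∩ B).card) with hF
  have hsub : {ω | 2 * (C ω j a \ B).card ≤ k} ⊆ ⋃ T ∈ F, {ω | C ω j a = T} := by
    intro ω hω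
    simp only [Set.mem_iUnion, Set.mem_ofPred_eq] at hω ⊢
    refine ⟨_, ?_, rfl⟩
    have h1 := hcard ω
    have h2 := Finset.card_sdiff_add_card_inter (C ω j a) B
    simp only [hF, Finset.mem_filter, Finset.mem_powersetCard_univ]
    omega
  -- A probability space has a point, whose committee is a set of `k` nodes; this makes `n.choose k`
  -- nonzero.
  have hkn : k ≤ n := by
    obtain ⟨ω⟩ := nonempty_of_isProbabilityMeasure μ
    simpa [hcard ω] using Finset.card_le_univ (C ω j a)
  have hpos : (0 : ℝ) < n.choose k := by exact_mod_cast Nat.choose_pos hkn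
  calc μ {ω | 2 * (C ω j a \ B).card ≤ k}
      ≤ ∑ T ∈ F, μ {ω | C ω j a = T} := (measure_mono hsub).trans (measure_biUnion_finset_le _ _)
    _ = ∑ T ∈ F, ((n.choose k : ℕ) : ENNReal)⁻¹ := Finset.sum_congr rfl fun T hT =>
        (hunif T (Finset.mem_powersetCard_univ.1 (Finset.mem_filter.1 hT).1)).2
    _ = ENNReal.ofReal (F.card / n.choose k) := by
        rw [Finset.sum_const, nsmul_eq_mul, ENNReal.ofReal_div_of_pos hpos,
          ENNReal.ofReal_natCast, ENNReal.ofReal_natCast, ENNReal.div_eq_inv_mul, mul_comm]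
    _ ≤ _ := ENNReal.ofReal_le_ofReal (by
        rw [div_le_iff₀ hpos, mul_comm]
        exact card_bad_le k B hB)

/-- All committees of a sender have an honest majority with probability at least `1 - ε`. -/
theorem UniformCommittees.measure_not_honestMajority_le {f φ k : ℕ}
    {C : Ω → Fin n → ℕ → Finset (Fin n)} (hC : UniformCommittees μ φ k C) (hφ : 1 ≤ φ)
    (B : Finset (Fin n)) (hB : 3 * B.card ≤ n) (j : Fin n) {ε : ℝ} (hε : 0 < ε)
    (hk : 18 * Real.log (φ / ε) ≤ k) :
    μ {ω | ¬ HonestMajority ⟨f, φ, k, B, C ω⟩ j} ≤ ENNReal.ofReal ε := by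
  have hsub : {ω | ¬ HonestMajority ⟨f, φ, k, B, C ω⟩ j} ⊆
      ⋃ a ∈ Finset.range φ, {ω | 2 * (C ω j a \ B).card ≤ k} := by
    intro ω hω
    simp only [HonestMajority, not_forall, not_lt, Set.mem_ofPred_eq] at hω
    obtain ⟨a, ha, h⟩ := hω
    simp only [Set.mem_iUnion, Finset.mem_range, Set.mem_ofPred_eq]
    exact ⟨a, ha, h⟩
  have hφ' : (0 : ℝ) < φ := by exact_mod_cast hφ
  calc μ {ω | ¬ HonestMajority ⟨f, φ, k, B, C ω⟩ j}
      ≤ ∑ a ∈ Finset.range φ, μ {ω | 2 * (C ω j a \ B).card ≤ k} :=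
        (measure_mono hsub).trans (measure_biUnion_finset_le _ _)
    _ ≤ ∑ a ∈ Finset.range φ, ENNReal.ofReal (Real.exp (-(k / 18))) :=
        Finset.sum_le_sum fun a ha => hC.measure_slot_le B hB j (Finset.mem_range.1 ha)
    _ = ENNReal.ofReal (φ * Real.exp (-(k / 18))) := by
        rw [Finset.sum_const, Finset.card_range, nsmul_eq_mul, ENNReal.ofReal_mul hφ'.le,
          ENNReal.ofReal_natCast]
    _ ≤ ENNReal.ofReal ε := by
        refine ENNReal.ofReal_le_ofReal ?_
        -- The bound on `k` makes each of the `φ` failure probabilities at most `ε / φ`.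
        have h1 : Real.exp (-(k / 18)) ≤ Real.exp (-Real.log (φ / ε)) :=
          Real.exp_le_exp.2 (by linarith)
        rw [Real.exp_neg (Real.log _), Real.exp_log (div_pos hφ' hε), inv_div] at h1
        calc (φ : ℝ) * Real.exp (-(k / 18)) ≤ φ * (ε / φ) := mul_le_mul_of_nonneg_left h1 hφ'.le
          _ = ε := by field_simp

end Sampling

end APMBRB

/-! ### The probabilistic statement -/

theorem mainTheorem3 {Ω : Type*} [MeasurableSpace Ω] (μ : Measure Ω) [IsProbabilityMeasure μ]
    {α : Type*} (n f φ nc : ℕ) (hn : 3 * f + 1 ≤ n) (hφ : 1 ≤ φ)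
    (byz : Finset (Fin n)) (hbyz : byz.card ≤ f)
    (C : Ω → Fin n → ℕ → Finset (Fin n)) (hC : APMBRB.UniformCommittees μ φ nc C)
    (run : Ω → ℕ → APMBRB.State n α)
    (hrun : ∀ ω, APMBRB.IsRun ⟨f, φ, nc, byz, C ω⟩ (run ω))
    (ε : ℝ) (hε : 0 < ε) (j : Fin n) :
    (18 * Real.log (φ / ε) ≤ nc →
      μ {ω | ¬ (APMBRB.Agreement ⟨f, φ, nc, byz, C ω⟩ (run ω) j {APMBRB.Rule.optimistic} ∧
        APMBRB.ChainSafe ⟨f, φ, nc, byz, C ω⟩ (run ω) j)} ≤ ENNReal.ofReal ε) ∧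
    (n = 3 * f + 1 →
      μ {ω | ¬ (APMBRB.HonestMajority ⟨f, φ, nc, byz, C ω⟩ j ∧
        APMBRB.HonestSigners ⟨f, φ, nc, byz, C ω⟩ (run ω) j)} ≤ ENNReal.ofReal ε →
      μ {ω | ¬ APMBRB.Agreement ⟨f, φ, nc, byz, C ω⟩ (run ω) j
        {APMBRB.Rule.optimistic, APMBRB.Rule.quorum}} ≤ ENNReal.ofReal ε) := by
  have hcard : ∀ ω, ∀ a < φ, (C ω j a).card = nc := fun ω a ha => (hC j a ha).1 ω
  refine ⟨fun hnc => ?_, fun hn' hass => ?_⟩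
  -- Safety holds for every run with honest majorities, so the bad event lies in the committee
  -- failure event however the run depends on `ω`. Monotonicity of `μ` requires no measurability of
  -- the bad event.
  · refine le_trans (measure_mono fun ω hω => ?_)
      (hC.measure_not_honestMajority_le (f := f) hφ byz (by omega) j hε hnc)
    rw [Set.mem_ofPred_eq] at hω ⊢
    exact fun hmaj => hω ⟨(hrun ω).agreement_optimistic hφ (hcard ω) hmaj hbyz,
      (hrun ω).chainSafe hφ (hcard ω) hmaj hbyz (show f < n by omega)⟩
  · refine le_trans (measure_mono fun ω hω => ?_) hass
    rw [Set.mem_ofPred_eq] at hω ⊢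
    exact fun h => hω ((hrun ω).agreement_quorum hφ (hcard ω) h.1 h.2 hbyz hn')
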